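/- Let $D\ge 2$ be an integer. Let $\Sigma=\Sigma_+\times\Sigma_+$, $\Sigma_+=\{0,\dots,D-1\}^{\mathbb N_*}$, be the space of two-sided sequences $\epsilon'\cdot\epsilon=\dots\epsilon'_2\epsilon'_1\cdot\epsilon_1\epsilon_2\dots$ with the product topology, let $B$ be the shift $\dots\epsilon'_2\epsilon'_1\cdot\epsilon_1\epsilon_2\dots\mapsto\dots\epsilon'_1\epsilon_1\cdot\epsilon_2\epsilon_3\dots$, and let $J:\Sigma\to\mathbb T^2=(\mathbb R/\mathbb Z)^2$, $J(\epsilon'\cdot\epsilon)=(0.\epsilon_1\epsilon_2\dots,\;0.\epsilon'_1\epsilon'_2\dots)$ (base $D$), be the coding map, through which the shift represents the $D$-baker's map $B(q,p)=\big(Dq \bmod 1,\;(p+\lfloor Dq\rfloor)/D\big)$ of $\mathbb T^2$ (with $q,p\in[0,1)$). Let $\mathcal F$ be the $D\times D$ matrix $\mathcal F_{jl}=D^{-1/2}e^{-2\pi i lj/D}$, and let $(e_j)_{0\le j<D}$ be the canonical basis of $\mathbb C^D$. On $\mathcal H_{D^k}=(\mathbb C^D)^{\otimes k}$ let $W_{D^k}(v^{(1)}\otimes\dots\otimes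 v^{(k)})=\mathcal F v^{(k)}\otimes\dots\otimes\mathcal F v^{(1)}$ be the Walsh transform. For $k\ge1$ the Walsh-quantized $D$-baker is the unitary operator $B_k=W_{D^k}^{-1}\,\mathrm{diag}(W_{D^{k-1}},\dots,W_{D^{k-1}})$, where the $D$ blocks correspond to the values of the first symbol of the position basis $e_{\epsilon_1}\otimes\dots\otimes e_{\epsilon_k}$. For $0\le\ell\le k$ and words $\epsilon$, $\epsilon'$ of lengths $\ell$ and $k-\ell$, the coherent state is $|\epsilon'\cdot\epsilon\rangle=e_{\epsilon_1}\otimes\dots\otimes e_{\epsilon_\ell}\otimes\mathcal F^*e_{\epsilon'_{k-\ell}}\otimes\dots\otimes\mathcal F^*e_{\epsilon'_1}$. The Walsh-Husimi measure $WH^{k,\ell}_\psi$ of a normalized $\psi\in\mathcal H_{D^k}$ is the probability measure on $\Sigma$ (or, through $J$, on $\mathbb T^2$) whose density with respect to Lebesgue measure (on $\Sigma$: independent uniform symbols) equals $D^k|\langle\psi|\epsilon'\cdot\epsilon\rangle|^2$ on each rectangle $[\epsilon'\cdot\epsilon]$. A probability measure $\mu$ is a semiclassical measure of the Walsh-quantized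 $D$-baker if there are integers $k_j\to\infty$ (strictly increasing), indices $0\le\ell_j\le k_j$ with $\ell_j\to\infty$ and $k_j-\ell_j\to\infty$, and normalized eigenstates $\psi_j$ of $B_{k_j}$, such that $WH^{k_j,\ell_j}_{\psi_j}$ converges weakly to $\mu$. Theorem. Let $\mu$ be a semiclassical measure of the Walsh-quantized $D$-baker, taken as a weak limit either on $\Sigma$ or on $\mathbb T^2$. Then the topological entropy of its support satisfies $$h_{top}(\operatorname{supp}\mu)\;\ge\;\frac{\log D}{2}.$$ Here $h_{top}(F)=\lim_{r\to0}\limsup_{n\to\infty}\frac1n\log N(r,n,F)$, where $N(r,n,F)$ is the minimal number of balls of radius $r$ for $d_n(x,y)=\max_{0\le m<n}d(T^mx,T^my)$ needed to cover $F$; on $\Sigma$, $T$ is the shift and $d$ is any metric for the product topology, and on $\mathbb T^2$, $T$ is the baker's map and $d$ is the flat metric. -/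

import Mathlib

open MeasureTheory Filter Topology

noncomputable section

namespace WalshBaker

/-! ### The symbolic phase space and the shift -/

/-- The space `Σ = Σ₊ × Σ₊` of two-sided sequences `ε' · ε` over the alphabet `{0, …, D-1}`.
A point is the pair `(ε', ε)`, and the symbol `εᵢ` (resp. `ε'ᵢ`), `i ≥ 1`, sits at index `i - 1`
of the second (resp. first) component. -/
abbrev Symb (D : ℕ) : Type := (ℕ → Fin D) × (ℕ → Fin D)

/-- The discrete uniform structure on the alphabet. The induced product uniform structure on
`Symb D` is the one of the distance `max (D ^ (-n₀')) (D ^ (-n₀))`, with `n₀`, `n₀'` the first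
places of disagreement on the right and on the left. -/
instance uniformSpaceAlphabet (D : ℕ) : UniformSpace (Fin D) := ⊥

/-- The shift: `… ε'₂ ε'₁ · ε₁ ε₂ …` goes to `… ε'₂ ε'₁ ε₁ · ε₂ ε₃ …`. -/
def shift (D : ℕ) (x : Symb D) : Symb D :=
  (fun n => match n with
    | 0 => x.2 0
    | m + 1 => x.1 m,
   fun n => x.2 (n + 1))

/-- Lebesgue measure on `Symb D`: every symbol is uniform and all symbols are independent. -/
def lebesgue (D : ℕ) : Measure (Symb D) :=
  (Measure.infinitePi fun _ : ℕ => ProbabilityTheory.uniformOn (Set.univ : Set (Fin D))).prod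
    (Measure.infinitePi fun _ : ℕ => ProbabilityTheory.uniformOn (Set.univ : Set (Fin D)))

/-! ### The torus and the baker's map -/

/-- The torus `(ℝ/ℤ)²`; the first coordinate is the position `q`, the second the momentum `p`. -/
abbrev Torus : Type := UnitAddCircle × UnitAddCircle

/-- The representative in `[0, 1)` of a point of `ℝ/ℤ`. -/
def rep (x : UnitAddCircle) : ℝ := (AddCircle.equivIco (1 : ℝ) 0 x : ℝ)

/-- The baker's map `B (q, p) = (D q mod 1, (p + ⌊D q⌋) / D)`. -/
def baker (D : ℕ) (x : Torus) : Torus :=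
  (((D * rep x.1 : ℝ) : UnitAddCircle),
   (((rep x.2 + (⌊(D : ℝ) * rep x.1⌋ : ℝ)) / D : ℝ) : UnitAddCircle))

/-- The coding map `ε' · ε ↦ (0.ε₁ε₂…, 0.ε'₁ε'₂…)` (base `D`) from sequences to the torus. -/
def code (D : ℕ) (x : Symb D) : Torus :=
  ((Real.ofDigits x.2 : UnitAddCircle), (Real.ofDigits x.1 : UnitAddCircle))

/-! ### Walsh quantization -/

/-- The quantum space of dimension `D ^ k`. The position basis is indexed by the words
`ε₁ … ε_k`, so that it is identified with `ℂ^D ⊗ ⋯ ⊗ ℂ^D`. -/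
abbrev QSpace (D k : ℕ) : Type := EuclideanSpace ℂ (Fin k → Fin D)

/-- The discrete Fourier transform `(F_D)_{jl} = D^{-1/2} exp (-2πi l j / D)`. -/
def dft (D : ℕ) : Matrix (Fin D) (Fin D) ℂ := fun j l =>
  (1 / (Real.sqrt D : ℂ)) *
    Complex.exp (-2 * Real.pi * Complex.I * ((l : ℕ) : ℂ) * ((j : ℕ) : ℂ) / (D : ℂ))

/-- The Walsh transform, i.e. the linear map with
`v₁ ⊗ ⋯ ⊗ v_k ↦ F v_k ⊗ F v_{k-1} ⊗ ⋯ ⊗ F v₁`, as a matrix in the position basis. -/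
def walsh (D k : ℕ) : Matrix (Fin k → Fin D) (Fin k → Fin D) ℂ := fun a b =>
  ∏ i : Fin k, dft D (a i) (b i.rev)

/-- The block-diagonal matrix of size `D ^ (m + 1)` with `D` blocks equal to `walsh D m`; the block
is selected by the first (most significant) symbol. -/
def blockWalsh (D m : ℕ) : Matrix (Fin (m + 1) → Fin D) (Fin (m + 1) → Fin D) ℂ := fun a b =>
  if a 0 = b 0 then walsh D m (Fin.tail a) (Fin.tail b) else 0

/-- The Walsh-quantized baker `B_k = (W_{D^k})⁻¹ diag (W_{D^{k-1}}, …, W_{D^{k-1}})`, for `k ≥ 1`.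
(The value at `k = 0` is a convention and is never used.) -/
def quantumBaker (D : ℕ) : (k : ℕ) → Matrix (Fin k → Fin D) (Fin k → Fin D) ℂ
  | 0 => 1
  | m + 1 => (walsh D (m + 1))⁻¹ * blockWalsh D m

/-- The pure tensor `v₁ ⊗ ⋯ ⊗ v_k`. -/
def pureTensor {D k : ℕ} (v : Fin k → Fin D → ℂ) : QSpace D k :=
  WithLp.toLp 2 fun a => ∏ i, v i (a i)

/-- The Walsh coherent state
`e_{ε₁} ⊗ ⋯ ⊗ e_{ε_ℓ} ⊗ F* e_{ε'_{k-ℓ}} ⊗ ⋯ ⊗ F* e_{ε'₁}` of the quantum rectangle `[ε' · ε]`,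
where `ε` has length `ℓ` and `ε'` has length `k - ℓ`. -/
def coherentState {D : ℕ} (k ℓ : ℕ) (ε' : Fin (k - ℓ) → Fin D) (ε : Fin ℓ → Fin D) : QSpace D k :=
  pureTensor fun i : Fin k =>
    if h : (i : ℕ) < ℓ then Pi.single (ε ⟨i, h⟩) 1
    else (dft D).conjTranspose.mulVec
      (Pi.single (ε' ⟨k - 1 - (i : ℕ), by have := i.isLt; omega⟩) 1)

/-- The Walsh-Husimi function `WH^{k,ℓ}_ψ`, equal to `D^k |⟨ψ | ε' · ε⟩|²` on the quantum
rectangle `[ε' · ε]`. -/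
def husimi {D : ℕ} (k ℓ : ℕ) (ψ : QSpace D k) (x : Symb D) : ℝ :=
  (D : ℝ) ^ k *
    ‖inner ℂ ψ (coherentState k ℓ (fun i => x.1 (i : ℕ)) (fun i => x.2 (i : ℕ)))‖ ^ 2

/-- The Walsh-Husimi measure on `Symb D`, with density `WH^{k,ℓ}_ψ`. -/
def husimiMeasure {D : ℕ} (k ℓ : ℕ) (ψ : QSpace D k) : Measure (Symb D) :=
  (lebesgue D).withDensity fun x => ENNReal.ofReal (husimi k ℓ ψ x)

/-- The Walsh-Husimi measure on the torus (the coding map sends Lebesgue measure to Lebesgue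
measure and cylinders to rectangles). -/
def torusHusimiMeasure {D : ℕ} (k ℓ : ℕ) (ψ : QSpace D k) : Measure Torus :=
  (husimiMeasure k ℓ ψ).map (code D)

/-! ### Semiclassical measures -/

/-- `ψ j` is a normalized eigenstate of `B_{k j}`, along a sequence of integers `k j → ∞`, and the
indices `ℓ j ≤ k j` satisfy the semiclassical condition `ℓ j → ∞`, `k j - ℓ j → ∞`. -/
structure IsSemiclassicalSequence (D : ℕ) (k ℓ : ℕ → ℕ) (ψ : (j : ℕ) → QSpace D (k j)) :
    Prop where
  one_le : ∀ j, 1 ≤ k j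
  strictMono : StrictMono k
  le : ∀ j, ℓ j ≤ k j
  tendsto_right : Tendsto ℓ atTop atTop
  tendsto_left : Tendsto (fun j => k j - ℓ j) atTop atTop
  normalized : ∀ j, ‖ψ j‖ = 1
  eigenstate : ∀ j, ∃ c : ℂ,
    Module.End.HasEigenvector (Matrix.toEuclideanLin (quantumBaker D (k j))) c (ψ j)

/-- Weak convergence of a sequence of measures. -/
def WeakLimit {X : Type*} [TopologicalSpace X] [MeasurableSpace X] (ν : ℕ → Measure X)
    (μ : Measure X) : Prop :=
  ∀ f : C(X, ℝ), Tendsto (fun j => ∫ x, f x ∂(ν j)) atTop (𝓝 (∫ x, f x ∂μ))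

/-- A semiclassical measure of the Walsh-quantized `D`-baker on `Symb D`: a probability measure
that is the weak limit of Husimi measures of a semiclassical sequence of eigenstates. -/
def IsSemiclassicalMeasure (D : ℕ) (μ : Measure (Symb D)) : Prop :=
  IsProbabilityMeasure μ ∧ ∃ (k ℓ : ℕ → ℕ) (ψ : (j : ℕ) → QSpace D (k j)),
    IsSemiclassicalSequence D k ℓ ψ ∧ WeakLimit (fun j => husimiMeasure (k j) (ℓ j) (ψ j)) μ

/-- A semiclassical measure of the Walsh-quantized `D`-baker on the torus. -/
def IsTorusSemiclassicalMeasure (D : ℕ) (μ : Measure Torus) : Prop :=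
  IsProbabilityMeasure μ ∧ ∃ (k ℓ : ℕ → ℕ) (ψ : (j : ℕ) → QSpace D (k j)),
    IsSemiclassicalSequence D k ℓ ψ ∧ WeakLimit (fun j => torusHusimiMeasure (k j) (ℓ j) (ψ j)) μ

end WalshBaker

end

noncomputable section

namespace WalshBaker

open scoped Matrix ComplexConjugate

/-! ### The discrete Fourier transform is unitary -/

/-! The entropy bound is a counting form of the uncertainty principle. The quantum baker moves the
first tensor factor to the last place and applies F* to it, so it turns one position slot of a mixed
product basis into a momentum slot while rotating the word (`quantumBaker_mixedState`). For an
eigenstate this makes the position law on words of length k equal to its momentum law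
(`mass_momentum`), and it gives every window of length n the law of the first n letters
(`sum_mass_window`).

Suppose a set G of n-letter words carries almost all the mass. By stationarity and Markov's
inequality, with mass at least 3/4 only a small proportion of the k/n consecutive blocks fall
outside G. There are at most about |G|^(k/n) such words (`card_few_badBlocks_le`). They carry most
of the mass in position and in momentum, so `uncertainty` forces their number to be at least of
order D^(k/2). As k → ∞ this gives D^n ≤ (|G| + 1)^2 (`pow_le_of_tendsto_badMass`).

Weak convergence sends the mass of closed sets off the support to 0. A cover of the support by
dynamical balls of length n supplies such a G, with at most one word per ball on Σ and nine on the
torus. Any cover thus has at least D^(n/2)/10 balls. -/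

lemma dft_eq_pow (D : ℕ) (j l : Fin D) :
    dft D j l = (1 / (Real.sqrt D : ℂ)) *
      conj (Complex.exp (2 * Real.pi * Complex.I / D) ^ ((l : ℕ) * (j : ℕ))) := by
  unfold dft
  rw [← Complex.exp_nat_mul, ← Complex.exp_conj]
  congr 2
  simp only [map_mul, map_div₀, map_natCast, map_ofNat, Complex.conj_ofReal, Complex.conj_I]
  push_cast
  ring

/-- The sum is geometric with ratio z = ζ^(j - j'), where ζ is a primitive D-th root of unity: z^D =
1, and z ≠ 1 unless j = j'. -/
lemma star_dft_mul_dft {D : ℕ} (hD : 2 ≤ D) (j j' : Fin D) :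
    ∑ l, conj (dft D j l) * dft D j' l = if j = j' then 1 else 0 := by
  have hD0 : (D : ℂ) ≠ 0 := by exact_mod_cast (by omega : D ≠ 0)
  have hζ := Complex.isPrimitiveRoot_exp D (by omega)
  set ζ := Complex.exp (2 * Real.pi * Complex.I / D) with hζdef
  have hnorm : ‖ζ‖ = 1 := hζ.norm'_eq_one (by omega)
  have hconj : conj ζ = ζ⁻¹ := (Complex.inv_eq_conj hnorm).symm
  have hζ0 : ζ ≠ 0 := hζ.ne_zero (by omega)
  have hs : (1 / (Real.sqrt D : ℂ)) * (1 / (Real.sqrt D : ℂ)) = 1 / D := by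
    rw [div_mul_div_comm, one_mul, ← Complex.ofReal_mul, Real.mul_self_sqrt (by positivity)]
    simp
  have hterm : ∀ l : Fin D, conj (dft D j l) * dft D j' l
      = 1 / D * (ζ ^ (j : ℕ) * (ζ⁻¹) ^ (j' : ℕ)) ^ (l : ℕ) := by
    intro l
    rw [dft_eq_pow, dft_eq_pow, ← hζdef, ← hs]
    simp only [map_mul, map_pow, hconj, map_div₀, map_one, Complex.conj_ofReal, map_inv₀, inv_inv]
    rw [mul_pow, pow_mul', pow_mul']
    ring
  simp_rw [hterm]
  rw [← Finset.mul_sum, Fin.sum_univ_eq_sum_range (fun l => (ζ ^ (j : ℕ) * ζ⁻¹ ^ (j' : ℕ)) ^ l)]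
  split_ifs with h
  · subst h
    simp [hζ0, hD0]
  · set z := ζ ^ (j : ℕ) * ζ⁻¹ ^ (j' : ℕ) with hz
    have hz1 : z ≠ 1 := by
      intro h1
      apply h
      rw [hz, inv_pow, mul_inv_eq_one₀ (pow_ne_zero _ hζ0)] at h1
      exact Fin.ext (hζ.pow_inj j.2 j'.2 h1)
    have hzD : z ^ D = 1 := by
      rw [hz, mul_pow, ← pow_mul, ← pow_mul, mul_comm (j : ℕ), mul_comm (j' : ℕ),
        pow_mul, pow_mul, inv_pow, hζ.pow_eq_one]
      simp
    have := mul_geom_sum z D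
    rw [hzD, sub_self, mul_eq_zero, sub_eq_zero] at this
    simp [this.resolve_left hz1]

lemma dft_symm (D : ℕ) (j l : Fin D) : dft D j l = dft D l j := by
  rw [dft_eq_pow, dft_eq_pow, mul_comm (l : ℕ)]

lemma norm_dft {D : ℕ} (j l : Fin D) : ‖dft D j l‖ ^ 2 = (D : ℝ)⁻¹ := by
  have hD : D ≠ 0 := by have := j.2; omega
  have hζ := Complex.isPrimitiveRoot_exp D hD
  rw [dft_eq_pow, norm_mul, RCLike.norm_conj, norm_pow, hζ.norm'_eq_one hD, one_pow, mul_one,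
    norm_div, norm_one, Complex.norm_real, Real.norm_of_nonneg (Real.sqrt_nonneg _), div_pow,
    Real.sq_sqrt (by positivity)]
  simp

lemma dft_mul_conjTranspose {D : ℕ} (hD : 2 ≤ D) : dft D * (dft D)ᴴ = 1 := by
  ext i j
  simp only [Matrix.mul_apply, Matrix.conjTranspose_apply, Matrix.one_apply]
  have := star_dft_mul_dft hD j i
  simp only [eq_comm (a := i), ← this]
  exact Finset.sum_congr rfl fun l _ => mul_comm _ _

/-! ### Matrices with product entries -/

lemma prod_ite_eq_ite {ι α : Type*} [Fintype ι] [DecidableEq ι] [DecidableEq α] (a c : ι → α) :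
    (∏ i, if a i = c i then (1 : ℂ) else 0) = if a = c then 1 else 0 := by
  rw [Finset.prod_ite_zero]
  simp [funext_iff]

lemma sum_prod_eq_prod_sum {ι α : Type*} [Fintype ι] [DecidableEq ι] [Fintype α]
    (f : ι → α → ℂ) : ∑ b : ι → α, ∏ i, f i (b i) = ∏ i, ∑ x, f i x := by
  rw [Finset.prod_univ_sum, Fintype.piFinset_univ]

lemma sum_eq_sum_cons {m : ℕ} {α : Type*} [Fintype α] (f : (Fin (m + 1) → α) → ℂ) :
    ∑ b, f b = ∑ x : α, ∑ t : Fin m → α, f (Fin.cons x t) := by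
  rw [← (Fin.consEquiv fun _ : Fin (m + 1) => α).sum_comp, Fintype.sum_prod_type]
  rfl

lemma conjTranspose_walsh_mul_walsh {D : ℕ} (hD : 2 ≤ D) (k : ℕ) :
    (walsh D k)ᴴ * walsh D k = 1 := by
  ext a c
  simp only [Matrix.mul_apply, Matrix.conjTranspose_apply, Matrix.one_apply, walsh]
  have : ∀ b : Fin k → Fin D, star (∏ i : Fin k, dft D (b i) (a i.rev)) *
      ∏ i : Fin k, dft D (b i) (c i.rev) =
      ∏ i : Fin k, (conj (dft D (a i.rev) (b i)) * dft D (c i.rev) (b i)) := by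
    intro b
    rw [Finset.prod_mul_distrib]
    simp only [dft_symm D (b _)]
    simp
  simp_rw [this]
  rw [sum_prod_eq_prod_sum fun (i : Fin k) (x : Fin D) =>
    conj (dft D (a i.rev) x) * dft D (c i.rev) x]
  simp_rw [star_dft_mul_dft hD]
  rw [prod_ite_eq_ite (fun i : Fin k => a i.rev) (fun i => c i.rev)]
  congr 1
  rw [eq_iff_iff]
  constructor
  · intro h
    funext i
    simpa using congrFun h i.rev
  · rintro rfl
    rfl

lemma walsh_mul_conjTranspose {D : ℕ} (hD : 2 ≤ D) (k : ℕ) :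
    walsh D k * (walsh D k)ᴴ = 1 :=
  mul_eq_one_comm.mp (conjTranspose_walsh_mul_walsh hD k)

lemma inv_walsh {D : ℕ} (hD : 2 ≤ D) (k : ℕ) : (walsh D k)⁻¹ = (walsh D k)ᴴ :=
  Matrix.inv_eq_left_inv (conjTranspose_walsh_mul_walsh hD k)

lemma conjTranspose_blockWalsh_mul_blockWalsh {D : ℕ} (hD : 2 ≤ D) (m : ℕ) :
    (blockWalsh D m)ᴴ * blockWalsh D m = 1 := by
  ext a c
  have h := congrFun (congrFun (conjTranspose_walsh_mul_walsh hD m) (Fin.tail a)) (Fin.tail c)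
  simp only [Matrix.mul_apply, Matrix.conjTranspose_apply, Matrix.one_apply, blockWalsh] at h ⊢
  rw [sum_eq_sum_cons]
  simp only [Fin.cons_zero, Fin.tail_cons, apply_ite star, star_zero, ite_mul,
    mul_ite, zero_mul, mul_zero]
  rw [Finset.sum_eq_single (a 0)]
  · simp only [if_true]
    by_cases h0 : a 0 = c 0
    · simp only [h0, if_true, h]
      congr 1
      rw [eq_iff_iff]
      constructor
      · intro ht
        rw [← Fin.cons_self_tail a, ← Fin.cons_self_tail c, h0, ht]
      · rintro rfl
        rfl
    · have : a ≠ c := fun h => h0 (congrFun h 0)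
      simp [h0, this]
  · intro b _ hb
    simp [hb]
  · simp

lemma conjTranspose_quantumBaker_mul {D : ℕ} (hD : 2 ≤ D) (k : ℕ) :
    (quantumBaker D k)ᴴ * quantumBaker D k = 1 := by
  cases k with
  | zero => simp [quantumBaker]
  | succ m =>
    rw [quantumBaker, inv_walsh hD, Matrix.conjTranspose_mul, Matrix.conjTranspose_conjTranspose,
      Matrix.mul_assoc, ← Matrix.mul_assoc (walsh D (m + 1)), walsh_mul_conjTranspose hD,
      Matrix.one_mul, conjTranspose_blockWalsh_mul_blockWalsh hD]

/-! ### Action on pure tensors -/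

lemma walsh_mulVec_prod {D k : ℕ} (v : Fin k → Fin D → ℂ) (a : Fin k → Fin D) :
    (walsh D k *ᵥ fun b => ∏ i, v i (b i)) a = ∏ i : Fin k, (dft D *ᵥ v i.rev) (a i) := by
  simp only [Matrix.mulVec, dotProduct, walsh]
  have h1 : ∏ i : Fin k, ∑ x, dft D (a i) x * v i.rev x
      = ∏ i : Fin k, ∑ x, dft D (a i.rev) x * v i x := by
    rw [← Equiv.prod_comp Fin.revPerm]
    simp
  rw [h1, Finset.prod_univ_sum, Fintype.piFinset_univ]
  refine Finset.sum_congr rfl fun b _ => ?_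
  rw [Finset.prod_mul_distrib]
  congr 1
  rw [← Equiv.prod_comp Fin.revPerm]
  simp

lemma blockWalsh_mulVec_prod {D m : ℕ} (v : Fin (m + 1) → Fin D → ℂ) (a : Fin (m + 1) → Fin D) :
    (blockWalsh D m *ᵥ fun b => ∏ i, v i (b i)) a
      = v 0 (a 0) * ∏ i : Fin m, (dft D *ᵥ v i.rev.succ) (a i.succ) := by
  have h := walsh_mulVec_prod (fun i : Fin m => v i.succ) (Fin.tail a)
  simp only [Fin.tail] at h
  rw [← h]
  simp only [Matrix.mulVec, dotProduct, blockWalsh]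
  rw [sum_eq_sum_cons, Finset.sum_eq_single (a 0)]
  · simp only [Fin.cons_zero, if_true, Fin.tail_cons, Finset.mul_sum]
    refine Finset.sum_congr rfl fun b _ => ?_
    simp only [Fin.prod_univ_succ, Fin.cons_zero, Fin.cons_succ]
    rw [mul_left_comm]
  · intro b _ hb
    simp [hb.symm]
  · simp

/-- The quantum baker shifts the tensor factors. -/
lemma quantumBaker_pureTensor {D m : ℕ} (hD : 2 ≤ D) (v : Fin (m + 1) → Fin D → ℂ) :
    Matrix.toEuclideanLin (quantumBaker D (m + 1)) (pureTensor v)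
      = pureTensor (Fin.snoc (α := fun _ => Fin D → ℂ) (fun i : Fin m => v i.succ)
          ((dft D)ᴴ *ᵥ v 0)) := by
  -- Multiplying by W avoids computing its inverse. W reverses the factors, so the F* in the last
  -- slot meets the F of the first slot and cancels.
  have key : blockWalsh D m *ᵥ (fun b => ∏ i, v i (b i)) = walsh D (m + 1) *ᵥ
      (fun b => ∏ i, (Fin.snoc (α := fun _ => Fin D → ℂ) (fun i : Fin m => v i.succ)
          ((dft D)ᴴ *ᵥ v 0) : Fin (m + 1) → Fin D → ℂ) i (b i)) := by
    funext a
    rw [blockWalsh_mulVec_prod, walsh_mulVec_prod, Fin.prod_univ_succ]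
    congr 1
    · rw [Fin.rev_zero, Fin.snoc_last, Matrix.mulVec_mulVec, dft_mul_conjTranspose hD,
        Matrix.one_mulVec]
    · refine Finset.prod_congr rfl fun i _ => ?_
      rw [Fin.rev_succ, Fin.snoc_castSucc]
  unfold pureTensor
  rw [Matrix.toLpLin_toLp, Matrix.toLin'_apply]
  congr 1
  rw [quantumBaker, ← Matrix.mulVec_mulVec, key, Matrix.mulVec_mulVec, inv_walsh hD,
    conjTranspose_walsh_mul_walsh hD, Matrix.one_mulVec]

lemma inner_quantumBaker {D k : ℕ} (hD : 2 ≤ D) (x y : QSpace D k) :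
    inner ℂ (Matrix.toEuclideanLin (quantumBaker D k) x)
        (Matrix.toEuclideanLin (quantumBaker D k) y)
      = inner ℂ x y := by
  rw [← LinearMap.adjoint_inner_right, ← Matrix.toEuclideanLin_conjTranspose_eq_adjoint,
    ← LinearMap.comp_apply, ← Matrix.toLpLin_mul_same, conjTranspose_quantumBaker_mul hD]
  simp

/-- For an eigenstate, overlaps are preserved in modulus by the quantum baker. -/
lemma norm_inner_quantumBaker {D k : ℕ} (hD : 2 ≤ D) {ψ : QSpace D k} (c : ℂ)
    (h : Module.End.HasEigenvector (Matrix.toEuclideanLin (quantumBaker D k)) c ψ)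
    (φ : QSpace D k) :
    ‖inner ℂ ψ (Matrix.toEuclideanLin (quantumBaker D k) φ)‖ = ‖inner ℂ ψ φ‖ := by
  have hψ := h.apply_eq_smul
  have hψ0 : ψ ≠ 0 := h.2
  have h1 := inner_quantumBaker hD ψ ψ
  have h2 := inner_quantumBaker hD ψ φ
  rw [hψ] at h1 h2
  rw [inner_smul_left, inner_smul_right, ← mul_assoc, mul_eq_right₀ (by simpa using hψ0),
    Complex.conj_mul'] at h1
  have hc : ‖c‖ = 1 := by
    have : ‖c‖ ^ 2 = 1 := by exact_mod_cast h1
    nlinarith [norm_nonneg c]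
  rw [← h2, inner_smul_left, norm_mul, RCLike.norm_conj, hc, one_mul]

/-! ### Mass of a word in a mixed position-momentum basis -/

/-- The position basis of a tensor factor of index less than `ℓ`, the momentum basis of the
other ones. -/
def localBasis (D ℓ i : ℕ) (s : Fin D) : Fin D → ℂ :=
  if i < ℓ then Pi.single s 1 else (dft D)ᴴ *ᵥ Pi.single s 1

/-- The product basis with `ℓ` position factors followed by momentum factors. -/
def mixedState {D k : ℕ} (ℓ : ℕ) (v : Fin k → Fin D) : QSpace D k :=
  pureTensor fun i => localBasis D ℓ i (v i)

/-- The weight of `ψ` on a vector of the product basis. -/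
def mass {D k : ℕ} (ψ : QSpace D k) (ℓ : ℕ) (v : Fin k → Fin D) : ℝ :=
  ‖inner ℂ ψ (mixedState ℓ v)‖ ^ 2

lemma mass_nonneg {D k : ℕ} (ψ : QSpace D k) (ℓ : ℕ) (v : Fin k → Fin D) : 0 ≤ mass ψ ℓ v :=
  sq_nonneg _

lemma localBasis_of_le {D ℓ i : ℕ} (h : ℓ ≤ i) (s a : Fin D) :
    localBasis D ℓ i s a = conj (dft D s a) := by
  rw [localBasis, if_neg (by omega)]
  simp

lemma sum_localBasis {D : ℕ} (hD : 2 ≤ D) (ℓ i : ℕ) (a b : Fin D) :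
    ∑ s, localBasis D ℓ i s a * conj (localBasis D ℓ i s b) = if a = b then 1 else 0 := by
  by_cases h : i < ℓ
  · simp [localBasis, h, Pi.single_apply]
  · simp only [localBasis_of_le (not_lt.mp h), Complex.conj_conj]
    rw [← star_dft_mul_dft hD a b]
    simp only [dft_symm D a, dft_symm D b]

lemma inner_pureTensor {D k : ℕ} (ψ : QSpace D k) (v : Fin k → Fin D → ℂ) :
    inner ℂ ψ (pureTensor v) = ∑ a, conj (ψ a) * ∏ i, v i (a i) := by
  rw [PiLp.inner_apply]
  refine Finset.sum_congr rfl fun a _ => ?_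
  rw [RCLike.inner_apply, mul_comm]
  rfl

/-- Over a product set of words, the squared overlaps expand into a double sum whose kernel factors
slot by slot. Slots can then be treated separately. -/
lemma sum_piFinset_mass {D k : ℕ} (ψ : QSpace D k) (ℓ : ℕ) (t : Fin k → Finset (Fin D)) :
    ((∑ v ∈ Fintype.piFinset t, mass ψ ℓ v : ℝ) : ℂ) = ∑ a, ∑ b, conj (ψ a) * ψ b *
      ∏ i : Fin k, ∑ s ∈ t i, localBasis D ℓ i s (a i) * conj (localBasis D ℓ i s (b i)) := by
  have h1 : ∀ v : Fin k → Fin D, ((mass ψ ℓ v : ℝ) : ℂ) = ∑ a, ∑ b, conj (ψ a) * ψ b *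
      ∏ i : Fin k, (localBasis D ℓ i (v i) (a i) * conj (localBasis D ℓ i (v i) (b i))) := by
    intro v
    rw [mass, Complex.ofReal_pow, ← Complex.mul_conj', mixedState, inner_pureTensor, map_sum,
      Finset.sum_mul_sum]
    refine Finset.sum_congr rfl fun a _ => Finset.sum_congr rfl fun b _ => ?_
    rw [Finset.prod_mul_distrib, map_mul, Complex.conj_conj, map_prod]
    ring
  push_cast
  simp_rw [h1]
  rw [Finset.sum_comm]
  refine Finset.sum_congr rfl fun a _ => ?_
  rw [Finset.sum_comm]
  refine Finset.sum_congr rfl fun b _ => ?_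
  rw [← Finset.mul_sum, Finset.prod_univ_sum]

/-- The first `n` letters of a word. -/
def pre {D k : ℕ} (n : ℕ) (h : n ≤ k) (v : Fin k → Fin D) : Fin n → Fin D :=
  fun i => v (Fin.castLE h i)

/-- A slot summed over all letters contributes the identity, by completeness of either basis. The
slots before n are in the position basis on both sides. -/
lemma sum_mass_pre_eq {D k n : ℕ} (hD : 2 ≤ D) (ψ : QSpace D k) (hn : n ≤ k) {ℓ ℓ' : ℕ}
    (h : n ≤ ℓ) (h' : n ≤ ℓ') (u : Fin n → Fin D) :
    ∑ v with pre n hn v = u, mass ψ ℓ v = ∑ v with pre n hn v = u, mass ψ ℓ' v := by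
  have hfilter : (Finset.univ.filter fun v : Fin k → Fin D => pre n hn v = u)
      = Fintype.piFinset fun i : Fin k => if h : (i : ℕ) < n then {u ⟨i, h⟩} else Finset.univ := by
    ext v
    simp only [Finset.mem_filter, Finset.mem_univ, true_and, Fintype.mem_piFinset]
    constructor
    · rintro rfl i
      split_ifs <;> simp [pre]
    · intro hv
      funext i
      have := hv (Fin.castLE hn i)
      simpa [pre] using this
  rw [hfilter, ← Complex.ofReal_inj, sum_piFinset_mass, sum_piFinset_mass]
  refine Finset.sum_congr rfl fun a _ => Finset.sum_congr rfl fun b _ => ?_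
  congr 1
  refine Finset.prod_congr rfl fun i _ => ?_
  split_ifs with hi
  · have h1 : (i : ℕ) < ℓ := by omega
    have h2 : (i : ℕ) < ℓ' := by omega
    simp [localBasis, h1, h2]
  · rw [sum_localBasis hD, sum_localBasis hD]

/-- The weight of `ψ` on the basis vectors whose first `n` letters form a word outside `G`. -/
def badMass {D k : ℕ} (ψ : QSpace D k) (ℓ n : ℕ) (h : n ≤ k) (G : Finset (Fin n → Fin D)) : ℝ :=
  ∑ v with pre n h v ∉ G, mass ψ ℓ v

lemma badMass_eq {D k n : ℕ} (hD : 2 ≤ D) (ψ : QSpace D k) (hn : n ≤ k) {ℓ ℓ' : ℕ}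
    (h : n ≤ ℓ) (h' : n ≤ ℓ') (G : Finset (Fin n → Fin D)) :
    badMass ψ ℓ n hn G = badMass ψ ℓ' n hn G := by
  have key : ∀ ℓ, badMass ψ ℓ n hn G = ∑ u with u ∉ G, ∑ v with pre n hn v = u, mass ψ ℓ v := by
    intro ℓ
    rw [badMass, ← Finset.sum_fiberwise_of_maps_to (t := Finset.univ.filter fun u => u ∉ G)
      (g := pre n hn) (by simp)]
    refine Finset.sum_congr rfl fun u hu => Finset.sum_congr ?_ fun _ _ => rfl
    ext v
    simp only [Finset.mem_filter, Finset.mem_univ, true_and] at hu ⊢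
    constructor
    · exact fun h => h.2
    · rintro rfl
      exact ⟨hu, rfl⟩
  rw [key, key]
  exact Finset.sum_congr rfl fun u _ => sum_mass_pre_eq hD ψ hn h h' u

lemma mass_position {D k : ℕ} (ψ : QSpace D k) (v : Fin k → Fin D) :
    mass ψ k v = ‖ψ v‖ ^ 2 := by
  rw [mass, mixedState, inner_pureTensor, Finset.sum_eq_single v]
  · simp [localBasis]
  · intro a _ ha
    obtain ⟨i, hi⟩ := Function.ne_iff.mp ha
    rw [Finset.prod_eq_zero (Finset.mem_univ i), mul_zero]
    simp [localBasis, hi]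
  · simp

lemma sum_mass {D k : ℕ} (hD : 2 ≤ D) (ψ : QSpace D k) (ℓ : ℕ) :
    ∑ v, mass ψ ℓ v = ‖ψ‖ ^ 2 := by
  -- For n = 0 and G = ∅ every word is bad, so independence of ℓ becomes Parseval's identity.
  have h := badMass_eq hD ψ (Nat.zero_le k) (Nat.zero_le ℓ) (Nat.zero_le k) ∅
  simp only [badMass, Finset.notMem_empty, not_false_eq_true, Finset.filter_true] at h
  rw [h, EuclideanSpace.norm_sq_eq]
  exact Finset.sum_congr rfl fun v _ => mass_position ψ v

lemma norm_mixedState_zero {D k : ℕ} (v a : Fin k → Fin D) :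
    ‖mixedState 0 v a‖ ^ 2 = ((D : ℝ) ^ k)⁻¹ := by
  have : mixedState 0 v a = ∏ i : Fin k, localBasis D 0 i (v i) (a i) := rfl
  rw [this, norm_prod, ← Finset.prod_pow]
  simp [localBasis_of_le (Nat.zero_le _), norm_dft]

/-! ### Stationarity of the word distribution of an eigenstate -/

lemma quantumBaker_mixedState {D k : ℕ} (hD : 2 ≤ D) {ℓ : ℕ} (hℓ : ℓ + 1 ≤ k)
    (v : Fin k → Fin D) :
    Matrix.toEuclideanLin (quantumBaker D k) (mixedState (ℓ + 1) v)
      = mixedState ℓ (v ∘ finRotate k) := by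
  obtain ⟨m, rfl⟩ : ∃ m, k = m + 1 := ⟨k - 1, by omega⟩
  rw [mixedState, quantumBaker_pureTensor hD, mixedState]
  congr 1
  funext i
  refine Fin.lastCases ?_ (fun j => ?_) i
  · rw [Fin.snoc_last]
    -- The hypothesis ℓ + 1 ≤ k makes the last slot a momentum slot, where the factor sent round
    -- with F* belongs.
    have h : ¬ (m : ℕ) < ℓ := by omega
    simp [localBasis, h]
  · rw [Fin.snoc_castSucc]
    simp [localBasis, Fin.coeSucc_eq_succ]

/-- The state `ψ` is an eigenvector of the quantum baker's map. -/
def IsEigenstate {D k : ℕ} (ψ : QSpace D k) : Prop :=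
  ∃ c : ℂ, Module.End.HasEigenvector (Matrix.toEuclideanLin (quantumBaker D k)) c ψ

lemma mass_comp_finRotate {D k : ℕ} (hD : 2 ≤ D) {ψ : QSpace D k} (hψ : IsEigenstate ψ) {ℓ : ℕ}
    (hℓ : ℓ + 1 ≤ k) (v : Fin k → Fin D) :
    mass ψ ℓ (v ∘ finRotate k) = mass ψ (ℓ + 1) v := by
  obtain ⟨c, hc⟩ := hψ
  rw [mass, mass, ← quantumBaker_mixedState hD hℓ, norm_inner_quantumBaker hD c hc]

lemma mass_comp_finRotate_pow {D k : ℕ} (hD : 2 ≤ D) {ψ : QSpace D k} (hψ : IsEigenstate ψ)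
    {s : ℕ} (hs : s ≤ k) (w : Fin k → Fin D) :
    mass ψ (k - s) (w ∘ (finRotate k ^ s : Equiv.Perm (Fin k))) = mass ψ k w := by
  induction s with
  | zero => simp
  | succ s ih =>
    rw [← ih (by omega), show k - s = k - (s + 1) + 1 by omega, ← mass_comp_finRotate hD hψ
      (by omega), pow_succ]
    rfl

lemma finRotate_pow_val {k : ℕ} (s : ℕ) (i : Fin k) :
    ((finRotate k ^ s : Equiv.Perm (Fin k)) i : ℕ) = (i + s) % k := by
  obtain ⟨m, rfl⟩ : ∃ m, k = m + 1 := ⟨k - 1, by have := i.2; omega⟩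
  induction s with
  | zero => simp [Nat.mod_eq_of_lt i.2]
  | succ s ih =>
    rw [pow_succ', Equiv.Perm.mul_apply, finRotate_apply, Fin.val_add, ih, Fin.val_one']
    simp [Nat.add_assoc]

lemma finRotate_pow_self (k : ℕ) : (finRotate k ^ k : Equiv.Perm (Fin k)) = 1 := by
  ext i
  simp [finRotate_pow_val, Nat.mod_eq_of_lt i.2]

/-- After k steps every slot has passed from position to momentum and the rotation is back to the
identity. -/
lemma mass_momentum {D k : ℕ} (hD : 2 ≤ D) {ψ : QSpace D k} (hψ : IsEigenstate ψ)
    (w : Fin k → Fin D) : mass ψ 0 w = mass ψ k w := by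
  have := mass_comp_finRotate_pow hD hψ le_rfl w
  rwa [finRotate_pow_self, Nat.sub_self] at this

/-- The subword of length `n` starting at `s`. -/
def window {D k : ℕ} (n s : ℕ) (h : s + n ≤ k) (w : Fin k → Fin D) : Fin n → Fin D :=
  fun i => w ⟨s + i, by have := i.2; omega⟩

/-- Rotating by s brings the window to the front. The remaining k - s ≥ n position slots still cover
it, and the law of the first n letters does not depend on their number. -/
lemma sum_mass_window {D k n s : ℕ} (hD : 2 ≤ D) {ψ : QSpace D k} (hψ : IsEigenstate ψ)
    (hs : s + n ≤ k) {ℓ : ℕ} (hℓ : n ≤ ℓ) (G : Finset (Fin n → Fin D)) :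
    ∑ w with window n s hs w ∉ G, mass ψ k w = badMass ψ ℓ n (by omega) G := by
  rw [badMass_eq hD ψ _ hℓ (show n ≤ k - s by omega), badMass, Finset.sum_filter,
    Finset.sum_filter]
  refine Fintype.sum_equiv
    (Equiv.arrowCongr (finRotate k ^ s : Equiv.Perm (Fin k)).symm (Equiv.refl _)) _ _ fun w => ?_
  have h1 : (Equiv.arrowCongr (finRotate k ^ s : Equiv.Perm (Fin k)).symm (Equiv.refl (Fin D))) w
      = w ∘ (finRotate k ^ s : Equiv.Perm (Fin k)) := rfl
  have h2 : pre n (by omega) (w ∘ (finRotate k ^ s : Equiv.Perm (Fin k))) = window n s hs w := by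
    funext i
    have := i.2
    simp only [pre, window, Function.comp_apply]
    congr 1
    ext
    rw [finRotate_pow_val, Fin.val_castLE, Nat.mod_eq_of_lt (by omega), add_comm]
  rw [h1, h2, mass_comp_finRotate_pow hD hψ (by omega)]

/-! ### The uncertainty principle -/

lemma mass_add_le {D k : ℕ} (x y : QSpace D k) (ℓ : ℕ) (v : Fin k → Fin D) :
    mass (x + y) ℓ v ≤ 2 * mass x ℓ v + 2 * mass y ℓ v := by
  simp only [mass, inner_add_left]
  have := norm_add_le (inner ℂ x (mixedState ℓ v)) (inner ℂ y (mixedState ℓ v))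
  nlinarith [sq_nonneg (‖inner ℂ x (mixedState ℓ v)‖ - ‖inner ℂ y (mixedState ℓ v)‖),
    norm_nonneg (inner ℂ x (mixedState ℓ v) + inner ℂ y (mixedState ℓ v)),
    norm_nonneg (inner ℂ x (mixedState ℓ v)), norm_nonneg (inner ℂ y (mixedState ℓ v))]

/-- Split ψ = x + y with x its restriction to S in position. Momentum vectors have entries of
constant modulus D^(-k/2), so by Cauchy-Schwarz each weighs x by at most |S| / D^k. The remainder y
has squared norm at most 1/4. -/
lemma uncertainty {D k : ℕ} (hD : 2 ≤ D) {ψ : QSpace D k} (hψ : ‖ψ‖ = 1)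
    (S : Finset (Fin k → Fin D)) (hpos : 3 / 4 ≤ ∑ w ∈ S, mass ψ k w)
    (hmom : 3 / 4 ≤ ∑ w ∈ S, mass ψ 0 w) : (D : ℝ) ^ k ≤ 8 * (S.card : ℝ) ^ 2 := by
  classical
  let x : QSpace D k := WithLp.toLp 2 fun a => if a ∈ S then ψ a else 0
  let y : QSpace D k := WithLp.toLp 2 fun a => if a ∈ S then 0 else ψ a
  have hxy : ψ = x + y := by
    ext a
    by_cases h : a ∈ S <;> simp [x, y, h]
  have hy : ‖y‖ ^ 2 ≤ 1 / 4 := by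
    have htot : ∑ w, mass ψ k w = 1 := by rw [sum_mass hD, hψ, one_pow]
    have hsplit := Finset.sum_add_sum_compl S (mass ψ k)
    have : ‖y‖ ^ 2 = ∑ w ∈ Sᶜ, mass ψ k w := by
      rw [EuclideanSpace.norm_sq_eq, ← Finset.sum_add_sum_compl S, Finset.sum_eq_zero, zero_add]
      · refine Finset.sum_congr rfl fun w hw => ?_
        rw [mass_position]
        simp [y, Finset.mem_compl.mp hw]
      · intro w hw
        simp [y, hw]
    linarith
  have hy' : ∑ w ∈ S, mass y 0 w ≤ 1 / 4 := by
    refine le_trans (Finset.sum_le_univ_sum_of_nonneg fun w => mass_nonneg y 0 w) ?_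
    rw [sum_mass hD]
    exact hy
  have hDk : (0 : ℝ) < (D : ℝ) ^ k := by positivity
  have hx : ∀ w, mass x 0 w ≤ S.card * ((D : ℝ) ^ k)⁻¹ := by
    intro w
    have h1 : inner ℂ x (mixedState 0 w) = ∑ a ∈ S, conj (ψ a) * mixedState 0 w a := by
      rw [mixedState, inner_pureTensor, ← Finset.sum_add_sum_compl S,
        Finset.sum_eq_zero (s := Sᶜ), add_zero]
      · refine Finset.sum_congr rfl fun a ha => ?_
        simp only [x, ha, if_true]
        rfl
      · intro a ha
        simp [x, Finset.mem_compl.mp ha]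
    rw [mass, h1]
    have h2 : ‖∑ a ∈ S, conj (ψ a) * mixedState 0 w a‖ ≤ ∑ a ∈ S, ‖ψ a‖ * ‖mixedState 0 w a‖ := by
      refine (norm_sum_le _ _).trans (le_of_eq (Finset.sum_congr rfl fun a _ => ?_))
      rw [norm_mul, RCLike.norm_conj]
    have h3 := Finset.sum_mul_sq_le_sq_mul_sq S (fun a => ‖ψ a‖) (fun a => ‖mixedState 0 w a‖)
    have h4 : ∑ a ∈ S, ‖ψ a‖ ^ 2 ≤ 1 := by
      refine (Finset.sum_le_univ_sum_of_nonneg fun a => sq_nonneg _).trans ?_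
      rw [← EuclideanSpace.norm_sq_eq, hψ, one_pow]
    have h5 : ∑ a ∈ S, ‖mixedState 0 w a‖ ^ 2 = S.card * ((D : ℝ) ^ k)⁻¹ := by
      rw [Finset.sum_congr rfl fun a _ => norm_mixedState_zero w a, Finset.sum_const, nsmul_eq_mul]
    rw [h5] at h3
    calc _ ≤ (∑ a ∈ S, ‖ψ a‖ * ‖mixedState 0 w a‖) ^ 2 := by gcongr
      _ ≤ _ := h3
      _ ≤ 1 * (S.card * ((D : ℝ) ^ k)⁻¹) := mul_le_mul_of_nonneg_right h4
        (mul_nonneg (Nat.cast_nonneg _) (inv_nonneg.mpr hDk.le))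
      _ = _ := one_mul _
  have hx' : ∑ w ∈ S, mass x 0 w ≤ S.card * (S.card * ((D : ℝ) ^ k)⁻¹) := by
    refine (Finset.sum_le_sum fun w _ => hx w).trans (le_of_eq ?_)
    simp
  have hle : ∑ w ∈ S, mass ψ 0 w ≤ 2 * ∑ w ∈ S, mass x 0 w + 2 * ∑ w ∈ S, mass y 0 w := by
    rw [Finset.mul_sum, Finset.mul_sum, ← Finset.sum_add_distrib]
    refine Finset.sum_le_sum fun w _ => ?_
    conv_lhs => rw [hxy]
    exact mass_add_le x y 0 w
  -- From 3/4 ≤ 2X + 2 · (1/4), with X the momentum mass of x on S.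
  have h8 : 1 / 8 ≤ (S.card : ℝ) ^ 2 * ((D : ℝ) ^ k)⁻¹ := by nlinarith
  rw [← div_eq_mul_inv, le_div_iff₀ hDk] at h8
  linarith

/-! ### Words most of whose blocks are good -/

lemma block_le {k m n : ℕ} (h : m * n ≤ k) (i : Fin m) : (i : ℕ) * n + n ≤ k := by
  have : ((i : ℕ) + 1) * n ≤ m * n := Nat.mul_le_mul_right n i.2
  linarith

/-- The number of consecutive blocks of length `n` which are not in `G`, among the first `m`. -/
def badBlocks {D k : ℕ} (m n : ℕ) (h : m * n ≤ k) (G : Finset (Fin n → Fin D))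
    (w : Fin k → Fin D) : ℕ :=
  (Finset.univ.filter fun i : Fin m => window n (i * n) (block_le h i) w ∉ G).card

lemma sum_mass_mul_badBlocks {D k m n : ℕ} (hD : 2 ≤ D) {ψ : QSpace D k} (hψ : IsEigenstate ψ)
    (h : m * n ≤ k) (hn : n ≤ k) {ℓ : ℕ} (hℓ : n ≤ ℓ) (G : Finset (Fin n → Fin D)) :
    ∑ w, mass ψ k w * badBlocks m n h G w = m * badMass ψ ℓ n hn G := by
  have h1 : ∀ w, mass ψ k w * badBlocks m n h G w
      = ∑ i : Fin m, if window n (i * n) (block_le h i) w ∉ G then mass ψ k w else 0 := by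
    intro w
    rw [← Finset.sum_filter, Finset.sum_const, nsmul_eq_mul, mul_comm]
    rfl
  have h2 : ∀ i : Fin m, (∑ w, if window n (i * n) (block_le h i) w ∉ G then mass ψ k w else 0)
      = badMass ψ ℓ n hn G := fun i =>
    (Finset.sum_filter _ _).symm.trans (sum_mass_window hD hψ (block_le h i) hℓ G)
  rw [Finset.sum_congr rfl fun w _ => h1 w, Finset.sum_comm, Finset.sum_congr rfl fun i _ => h2 i,
    Finset.sum_const, Finset.card_univ, Fintype.card_fin, nsmul_eq_mul]

/-- An exponential Markov bound: give a bad block weight D^(-n) and a good one weight 1. One block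
then has total weight at most |G| + 1, while a counted word has weight at least a^(-m). The last k -
mn letters are free. -/
lemma card_few_badBlocks_le {D k m n q : ℕ} (hD : 2 ≤ D) (h : m * n ≤ k)
    (G : Finset (Fin n → Fin D)) {a : ℝ} (ha : 1 ≤ a) (haq : (D : ℝ) ^ n ≤ a ^ q) :
    (((Finset.univ.filter fun w : Fin k → Fin D => q * badBlocks m n h G w ≤ m).card : ℕ) : ℝ)
      ≤ a ^ m * (G.card + 1) ^ m * (D : ℝ) ^ (k - m * n) := by
  have hDn : (0 : ℝ) < (D : ℝ) ^ n := by positivity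
  let f : (Fin n → Fin D) → ℝ := fun u => if u ∉ G then ((D : ℝ) ^ n)⁻¹ else 1
  have hf0 : ∀ u, 0 ≤ f u := by
    intro u
    simp only [f]
    split_ifs <;> positivity
  have hfprod : ∀ w : Fin k → Fin D, ∏ i : Fin m, f (window n (i * n) (block_le h i) w)
      = (((D : ℝ) ^ n) ^ badBlocks m n h G w)⁻¹ := by
    intro w
    simp only [f]
    rw [Finset.prod_ite, Finset.prod_const, Finset.prod_const_one, mul_one, inv_pow]
    rfl
  have hsum : ∑ u, f u ≤ G.card + 1 := by
    simp only [f]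
    rw [Finset.sum_ite, Finset.sum_const, Finset.sum_const, nsmul_eq_mul, nsmul_eq_mul, mul_one,
      add_comm]
    gcongr
    · simp
    · rw [← div_eq_mul_inv, div_le_one hDn]
      refine (Nat.cast_le.mpr (Finset.card_le_univ _)).trans ?_
      simp
  let split : (Fin k → Fin D) → (Fin m → Fin n → Fin D) × (Fin (k - m * n) → Fin D) := fun w =>
    (fun i => window n (i * n) (block_le h i) w,
      window (k - m * n) (m * n) (by omega) w)
  have hsplit : Function.Injective split := by
    intro w w' hw
    funext j
    have hw1 := congrArg Prod.fst hw
    have hw2 := congrArg Prod.snd hw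
    by_cases hj : (j : ℕ) < m * n
    · have hn : 0 < n := by
        rcases Nat.eq_zero_or_pos n with rfl | hn
        · simp at hj
        · exact hn
      have := congrFun (congrFun hw1 ⟨j / n, Nat.div_lt_of_lt_mul (by rwa [mul_comm])⟩)
        ⟨j % n, Nat.mod_lt _ hn⟩
      simpa [split, window, Nat.div_add_mod'] using this
    · have := congrFun hw2 ⟨j - m * n, by omega⟩
      simpa [split, window, Nat.add_sub_cancel' (not_lt.mp hj)] using this
  calc (((Finset.univ.filter fun w : Fin k → Fin D => q * badBlocks m n h G w ≤ m).card : ℕ) : ℝ)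
      = ∑ w with q * badBlocks m n h G w ≤ m, (1 : ℝ) := by simp
    _ ≤ ∑ w with q * badBlocks m n h G w ≤ m,
          a ^ m * ∏ i : Fin m, f (window n (i * n) (block_le h i) w) := by
        refine Finset.sum_le_sum fun w hw => ?_
        have hw : q * badBlocks m n h G w ≤ m := (Finset.mem_filter.mp hw).2
        rw [hfprod, ← div_eq_mul_inv, le_div_iff₀ (by positivity), one_mul]
        calc ((D : ℝ) ^ n) ^ badBlocks m n h G w ≤ (a ^ q) ^ badBlocks m n h G w := by gcongr
          _ = a ^ (q * badBlocks m n h G w) := (pow_mul _ _ _).symm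
          _ ≤ a ^ m := pow_le_pow_right₀ ha hw
    _ ≤ ∑ w : Fin k → Fin D, a ^ m * ∏ i : Fin m, f (window n (i * n) (block_le h i) w) :=
        Finset.sum_le_univ_sum_of_nonneg fun w =>
          mul_nonneg (by positivity) (Finset.prod_nonneg fun i _ => hf0 _)
    _ = a ^ m * ∑ w : Fin k → Fin D, ∏ i : Fin m, f ((split w).1 i) := by
        rw [Finset.mul_sum]
    _ ≤ a ^ m * ∑ p : (Fin m → Fin n → Fin D) × (Fin (k - m * n) → Fin D),
          ∏ i : Fin m, f (p.1 i) := by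
        gcongr
        rw [← Finset.sum_image (f := fun p : (Fin m → Fin n → Fin D) × (Fin (k - m * n) → Fin D) =>
          ∏ i : Fin m, f (p.1 i)) hsplit.injOn]
        exact Finset.sum_le_univ_sum_of_nonneg fun p => Finset.prod_nonneg fun i _ => hf0 _
    _ = a ^ m * ((∑ u, f u) ^ m * (D : ℝ) ^ (k - m * n)) := by
        rw [Fintype.sum_prod_type]
        simp only [Finset.sum_const, nsmul_eq_mul, ← Finset.mul_sum]
        rw [Fintype.sum_pow]
        simp [mul_comm]
    _ ≤ _ := by
        rw [mul_assoc]
        gcongr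

lemma pow_le_of_badMass_le {D k n q : ℕ} (hD : 2 ≤ D) {ψ : QSpace D k} (hψ : IsEigenstate ψ)
    (hψ1 : ‖ψ‖ = 1) (hn1 : 1 ≤ n) (hn : n ≤ k) {ℓ : ℕ} (hℓ : n ≤ ℓ) (G : Finset (Fin n → Fin D))
    (hbad : q * badMass ψ ℓ n hn G ≤ 1 / 4)
    {a : ℝ} (ha : 1 ≤ a) (haq : (D : ℝ) ^ n ≤ a ^ q) :
    ((D : ℝ) ^ n) ^ (k / n) ≤ 8 * ((D : ℝ) ^ n) ^ 2 * ((a * (G.card + 1)) ^ 2) ^ (k / n) := by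
  set m := k / n with hm
  have h : m * n ≤ k := Nat.div_mul_le_self k n
  have hr : k - m * n ≤ n := by
    have h1 := Nat.div_add_mod' k n
    have h2 := Nat.mod_lt k hn1
    rw [← hm] at h1
    omega
  have hD1 : (1 : ℝ) ≤ D := by exact_mod_cast (by omega : 1 ≤ D)
  let S := Finset.univ.filter fun w : Fin k → Fin D => q * badBlocks m n h G w ≤ m
  have hm0 : (0 : ℝ) < m := by
    have : 0 < m := Nat.div_pos hn hn1
    exact_mod_cast this
  have hSc : ∑ w ∈ Sᶜ, mass ψ k w ≤ 1 / 4 := by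
    -- Markov's inequality; by stationarity the mean number of bad blocks is m times the bad mass.
    have h1 : m * ∑ w ∈ Sᶜ, mass ψ k w ≤ q * (m * badMass ψ ℓ n hn G) := by
      rw [← sum_mass_mul_badBlocks hD hψ h hn hℓ G, Finset.mul_sum, Finset.mul_sum]
      calc ∑ w ∈ Sᶜ, m * mass ψ k w
          ≤ ∑ w ∈ Sᶜ, q * (mass ψ k w * badBlocks m n h G w) := by
            refine Finset.sum_le_sum fun w hw => ?_
            have hw' : m < q * badBlocks m n h G w := by
              simpa [S] using hw
            have hw'' : (m : ℝ) ≤ q * badBlocks m n h G w := by exact_mod_cast hw'.le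
            have := mul_le_mul_of_nonneg_right hw'' (mass_nonneg ψ k w)
            linarith
        _ ≤ _ := Finset.sum_le_univ_sum_of_nonneg fun w => by
            have := mass_nonneg ψ k w
            positivity
    have h2 : m * ∑ w ∈ Sᶜ, mass ψ k w ≤ m * (1 / 4) := by
      calc _ ≤ _ := h1
        _ = m * (q * badMass ψ ℓ n hn G) := by ring
        _ ≤ _ := by gcongr
    exact le_of_mul_le_mul_left h2 hm0
  have hS : 3 / 4 ≤ ∑ w ∈ S, mass ψ k w := by
    have htot : ∑ w, mass ψ k w = 1 := by rw [sum_mass hD, hψ1, one_pow]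
    have := Finset.sum_add_sum_compl S (mass ψ k)
    linarith
  have hS' : 3 / 4 ≤ ∑ w ∈ S, mass ψ 0 w := by
    simpa only [mass_momentum hD hψ] using hS
  have hunc := uncertainty hD hψ1 S hS hS'
  have hcard := card_few_badBlocks_le hD h G ha haq
  calc ((D : ℝ) ^ n) ^ m = (D : ℝ) ^ (m * n) := by rw [← pow_mul, mul_comm]
    _ ≤ (D : ℝ) ^ k := pow_le_pow_right₀ hD1 h
    _ ≤ 8 * (S.card : ℝ) ^ 2 := hunc
    _ ≤ 8 * (a ^ m * (G.card + 1) ^ m * (D : ℝ) ^ (k - m * n)) ^ 2 := by gcongr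
    _ ≤ 8 * (a ^ m * (G.card + 1) ^ m * (D : ℝ) ^ n) ^ 2 := by gcongr
    _ = _ := by rw [← pow_mul (a * _), mul_comm 2 m, pow_mul, mul_pow a]; ring

lemma le_of_pow_le_mul_pow {x y C : ℝ} (hy : 0 < y) {m : ℕ → ℕ} (hm : Tendsto m atTop atTop)
    (h : ∀ᶠ j in atTop, x ^ m j ≤ C * y ^ m j) : x ≤ y := by
  by_contra hxy
  have hxy : 1 < x / y := by rwa [one_lt_div hy, ← not_le]
  have ht := (tendsto_pow_atTop_atTop_of_one_lt hxy).comp hm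
  obtain ⟨j, hj1, hj2⟩ := ((ht.eventually_gt_atTop C).and h).exists
  simp only [Function.comp_apply, div_pow] at hj1
  rw [lt_div_iff₀ (by positivity)] at hj1
  linarith

/-- A set of words of length `n` carrying asymptotically all the mass of eigenstates has at least
about `D ^ (n / 2)` elements. -/
lemma pow_le_of_tendsto_badMass {D n : ℕ} (hD : 2 ≤ D) (hn1 : 1 ≤ n) {k ℓ : ℕ → ℕ}
    {ψ : (j : ℕ) → QSpace D (k j)} (hψ : IsSemiclassicalSequence D k ℓ ψ)
    (hn : ∀ j, n ≤ k j) (G : Finset (Fin n → Fin D))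
    (hbad : Tendsto (fun j => badMass (ψ j) (ℓ j) n (hn j) G) atTop (𝓝 0)) :
    (D : ℝ) ^ n ≤ ((G.card : ℝ) + 1) ^ 2 := by
  have key : ∀ a : ℝ, 1 < a → (D : ℝ) ^ n ≤ (a * (G.card + 1)) ^ 2 := by
    intro a ha
    -- Here q depends only on a and n, so q times the bad mass still tends to 0; a goes to 1 last.
    obtain ⟨q, hq⟩ := pow_unbounded_of_one_lt ((D : ℝ) ^ n) ha
    have hbad' : Tendsto (fun j => q * badMass (ψ j) (ℓ j) n (hn j) G) atTop (𝓝 0) := by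
      simpa using hbad.const_mul (q : ℝ)
    refine le_of_pow_le_mul_pow (C := 8 * ((D : ℝ) ^ n) ^ 2) (m := fun j => k j / n)
      (by positivity) ((Nat.tendsto_div_const_atTop (by omega)).comp hψ.strictMono.tendsto_atTop) ?_
    filter_upwards [hbad'.eventually_le_const (show (0 : ℝ) < 1 / 4 by norm_num),
      hψ.tendsto_right.eventually_ge_atTop n] with j hj1 hj2
    exact pow_le_of_badMass_le hD (hψ.eigenstate j) (hψ.normalized j) hn1 (hn j) hj2 G hj1 ha.le
      hq.le
  have ht : Tendsto (fun a : ℝ => (a * (G.card + 1)) ^ 2) (𝓝[>] 1)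
      (𝓝 ((1 * ((G.card : ℝ) + 1)) ^ 2)) := by
    refine Tendsto.mono_left ?_ nhdsWithin_le_nhds
    exact Continuous.tendsto (by fun_prop) 1
  rw [one_mul] at ht
  exact ge_of_tendsto ht (eventually_mem_nhdsWithin.mono key)

/-! ### The Husimi measure of an event on the first letters -/

/-- The word of tensor factors of the coherent state whose quantum rectangle contains `x`. -/
def factorWord {D : ℕ} (k ℓ : ℕ) (x : Symb D) : Fin k → Fin D :=
  fun i => if (i : ℕ) < ℓ then x.2 i else x.1 (k - 1 - i)

lemma husimi_eq {D k ℓ : ℕ} (ψ : QSpace D k) (x : Symb D) :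
    husimi k ℓ ψ x = (D : ℝ) ^ k * mass ψ ℓ (factorWord k ℓ x) := by
  unfold husimi mass mixedState coherentState
  congr 5
  funext i
  by_cases h : (i : ℕ) < ℓ <;> simp [localBasis, factorWord, h]

lemma measurable_factorWord {D : ℕ} (k ℓ : ℕ) :
    Measurable (factorWord k ℓ : Symb D → Fin k → Fin D) := by
  refine measurable_pi_lambda _ fun i => ?_
  unfold factorWord
  split_ifs
  · exact (measurable_pi_apply _).comp measurable_snd
  · exact (measurable_pi_apply _).comp measurable_fst

lemma isProbabilityMeasure_uniform {D : ℕ} (hD : 2 ≤ D) :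
    IsProbabilityMeasure (ProbabilityTheory.uniformOn (Set.univ : Set (Fin D))) := by
  have : Nonempty (Fin D) := ⟨⟨0, by omega⟩⟩
  exact ProbabilityTheory.isProbabilityMeasure_uniformOn Set.finite_univ Set.univ_nonempty

lemma lebesgue_factorWord {D k ℓ : ℕ} (hD : 2 ≤ D) (hℓ : ℓ ≤ k) (v : Fin k → Fin D) :
    lebesgue D {x | factorWord k ℓ x = v} = ((D : ENNReal) ^ k)⁻¹ := by
  have := isProbabilityMeasure_uniform hD
  -- The condition is vacuous for j ≥ k, which makes `t` a total family.
  let t : ℕ → Set (Fin D) := fun j => {a | ∀ h : j < k, a = v ⟨j, h⟩}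
  have ht : ∀ j, j < k →
      ProbabilityTheory.uniformOn (Set.univ : Set (Fin D)) (t j) = (D : ENNReal)⁻¹ := by
    intro j hj
    have : t j = {v ⟨j, hj⟩} := by
      ext a
      simp [t, hj]
    rw [this, ProbabilityTheory.uniformOn_univ]
    simp
  have hset : {x : Symb D | factorWord k ℓ x = v}
      = (Set.pi (Finset.range (k - ℓ)) fun j => t (k - 1 - j)) ×ˢ Set.pi (Finset.range ℓ) t := by
    ext x
    simp only [Set.mem_ofPred_eq, Set.mem_prod, Set.mem_pi, Finset.coe_range, Set.mem_Iio, t]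
    constructor
    · rintro rfl
      refine ⟨fun j hj h => ?_, fun j hj h => ?_⟩
      · have h1 : ¬ k - 1 - j < ℓ := by omega
        have h2 : k - 1 - (k - 1 - j) = j := by omega
        simp [factorWord, h1, h2]
      · simp [factorWord, hj]
    · rintro ⟨h1, h2⟩
      funext i
      have hi := i.2
      by_cases h : (i : ℕ) < ℓ
      · simp [factorWord, h, h2 i h hi]
      · have h3 : k - 1 - (k - 1 - (i : ℕ)) = i := by omega
        have := h1 (k - 1 - i) (by omega) (by omega)
        simp only [h3] at this
        simp [factorWord, h, this]
  rw [hset, lebesgue, Measure.prod_prod, Measure.infinitePi_pi _ fun _ _ => .of_discrete,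
    Measure.infinitePi_pi _ fun _ _ => .of_discrete,
    Finset.prod_congr rfl fun j hj => ht _ (by have := Finset.mem_range.mp hj; omega),
    Finset.prod_congr (s₁ := Finset.range ℓ) rfl
      fun j hj => ht _ (by have := Finset.mem_range.mp hj; omega)]
  simp only [Finset.prod_const, Finset.card_range]
  rw [← pow_add, Nat.sub_add_cancel hℓ, ENNReal.inv_pow]

/-- The first `n` letters of the right half of a two-sided sequence. -/
def firstLetters {D : ℕ} (n : ℕ) (x : Symb D) : Fin n → Fin D := fun i => x.2 i

/-- The density is constant on cells of volume D^(-k), so its factor D^k cancels. As n ≤ ℓ, the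
event depends only on the leading position letters. -/
lemma husimiMeasure_firstLetters {D k ℓ n : ℕ} (hD : 2 ≤ D) (ψ : QSpace D k) (hn : n ≤ ℓ)
    (hℓ : ℓ ≤ k) (G : Finset (Fin n → Fin D)) :
    husimiMeasure k ℓ ψ {x | firstLetters n x ∉ G}
      = ENNReal.ofReal (badMass ψ ℓ n (hn.trans hℓ) G) := by
  have hD0 : (0 : ℝ) < (D : ℝ) ^ k := by positivity
  have hset : {x : Symb D | firstLetters n x ∉ G}
      = factorWord k ℓ ⁻¹' {v | pre n (hn.trans hℓ) v ∉ G} := by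
    ext x
    have : pre n (hn.trans hℓ) (factorWord k ℓ x) = firstLetters n x := by
      funext i
      have : (i : ℕ) < ℓ := by omega
      simp [pre, factorWord, firstLetters, this]
    simp [this]
  have hmeas : MeasurableSet {v : Fin k → Fin D | pre n (hn.trans hℓ) v ∉ G} := .of_discrete
  have hmap : ∀ v, (lebesgue D).map (factorWord k ℓ) {v} = ((D : ENNReal) ^ k)⁻¹ := by
    intro v
    rw [Measure.map_apply (measurable_factorWord k ℓ) (.of_discrete),
      ← lebesgue_factorWord hD hℓ v]
    rfl
  have hone : ENNReal.ofReal ((D : ℝ) ^ k) * ((D : ENNReal) ^ k)⁻¹ = 1 := by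
    rw [ENNReal.ofReal_pow (by positivity), ENNReal.ofReal_natCast]
    exact ENNReal.mul_inv_cancel (by simp; omega) (by simp)
  unfold husimiMeasure
  rw [hset, withDensity_apply _ (measurable_factorWord k ℓ hmeas)]
  simp only [husimi_eq]
  rw [← setLIntegral_map (f := fun v => ENNReal.ofReal ((D : ℝ) ^ k * mass ψ ℓ v)) hmeas
    (.of_discrete) (measurable_factorWord k ℓ), ← lintegral_indicator hmeas, lintegral_fintype,
    badMass, ENNReal.ofReal_sum_of_nonneg fun v _ => mass_nonneg ψ ℓ v, Finset.sum_filter]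
  refine Finset.sum_congr rfl fun v _ => ?_
  rw [hmap, Set.indicator_apply]
  simp only [Set.mem_ofPred_eq]
  split_ifs with h
  · rw [zero_mul]
  · rw [ENNReal.ofReal_mul hD0.le, mul_right_comm, hone, one_mul]

lemma isFiniteMeasure_husimiMeasure {D k ℓ : ℕ} (hD : 2 ≤ D) (ψ : QSpace D k) (hℓ : ℓ ≤ k) :
    IsFiniteMeasure (husimiMeasure k ℓ ψ) := by
  have h := husimiMeasure_firstLetters hD ψ (Nat.zero_le ℓ) hℓ ∅
  simp only [Finset.notMem_empty, not_false_eq_true, Set.ofPred_true] at h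
  exact ⟨by rw [h]; exact ENNReal.ofReal_lt_top⟩

/-! ### Weak limits and supports -/

lemma WeakLimit.tendsto_measureReal {X : Type*} [TopologicalSpace X] [CompactSpace X]
    [NormalSpace X] [HereditarilyLindelofSpace X] [MeasurableSpace X] [OpensMeasurableSpace X]
    {ν : ℕ → Measure X} [∀ j, IsFiniteMeasure (ν j)] {μ : Measure X} (h : WeakLimit ν μ)
    {K : Set X} (hK : IsClosed K) (hdisj : Disjoint μ.support K) :
    Tendsto (fun j => (ν j).real K) atTop (𝓝 0) := by
  obtain ⟨f, hf0, hf1, hf⟩ :=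
    exists_continuous_zero_one_of_isClosed (Measure.isClosed_support (μ := μ)) hK hdisj
  have hlim : ∫ x, f x ∂μ = 0 := by
    refine integral_eq_zero_of_ae ?_
    filter_upwards [Measure.support_mem_ae (μ := μ)] with x hx using hf0 hx
  refine squeeze_zero (fun j => measureReal_nonneg) (fun j => ?_) (hlim ▸ h f)
  rw [← integral_indicator_one hK.measurableSet]
  refine integral_mono ((integrable_const 1).indicator hK.measurableSet) ?_ fun x => ?_
  · exact f.continuous.integrable_of_hasCompactSupport (.of_compactSpace _)
  · by_cases hx : x ∈ K
    · simp [hx, hf1 hx]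
    · simp [hx, (hf x).1]

lemma IsSemiclassicalSequence.tail {D : ℕ} {k ℓ : ℕ → ℕ} {ψ : (j : ℕ) → QSpace D (k j)}
    (h : IsSemiclassicalSequence D k ℓ ψ) (N : ℕ) :
    IsSemiclassicalSequence D (fun j => k (j + N)) (fun j => ℓ (j + N)) (fun j => ψ (j + N)) where
  one_le j := h.one_le _
  strictMono i j hij := h.strictMono (by omega)
  le j := h.le _
  tendsto_right := (tendsto_add_atTop_iff_nat N).mpr h.tendsto_right
  tendsto_left := (tendsto_add_atTop_iff_nat N).mpr h.tendsto_left
  normalized j := h.normalized _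
  eigenstate j := h.eigenstate _

lemma IsSemiclassicalSequence.pow_le {D n : ℕ} (hD : 2 ≤ D) (hn1 : 1 ≤ n) {k ℓ : ℕ → ℕ}
    {ψ : (j : ℕ) → QSpace D (k j)} (h : IsSemiclassicalSequence D k ℓ ψ)
    (G : Finset (Fin n → Fin D))
    (hbad : Tendsto (fun j => (husimiMeasure (k j) (ℓ j) (ψ j)).real {x | firstLetters n x ∉ G})
      atTop (𝓝 0)) :
    (D : ℝ) ^ n ≤ ((G.card : ℝ) + 1) ^ 2 := by
  obtain ⟨N, hN⟩ := eventually_atTop.mp (h.tendsto_right.eventually_ge_atTop n)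
  have hℓ : ∀ j, n ≤ ℓ (j + N) := fun j => hN _ (by omega)
  refine pow_le_of_tendsto_badMass hD hn1 (h.tail N) (fun j => (hℓ j).trans (h.le _)) G ?_
  refine ((tendsto_add_atTop_iff_nat N).mpr hbad).congr fun j => ?_
  rw [measureReal_def, husimiMeasure_firstLetters hD _ (hℓ j) (h.le _), ENNReal.toReal_ofReal]
  exact Finset.sum_nonneg fun v _ => mass_nonneg _ _ _

open Dynamics Uniformity

/-! ### Lower bounds for the entropy -/

/-- The hypothesis forces at least D^(n/2)/10 points in a cover, and a constant factor does not
affect the growth rate. The 9 is the multiplicity met on the torus. -/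
lemma log_div_two_le_coverEntropyEntourage {X : Type*} {T : X → X} {F : Set X} {U : SetRel X X}
    {D : ℕ} (hD : 2 ≤ D)
    (h : ∀ n : ℕ, 1 ≤ n → ∀ s : Finset X, IsDynCoverOf T F U n s →
      (D : ℝ) ^ n ≤ (9 * (s.card : ℝ) + 1) ^ 2) :
    ((Real.log D / 2 : ℝ) : EReal) ≤ coverEntropyEntourage T F U := by
  have hD0 : (0 : ℝ) < D := by positivity
  rw [coverEntropyEntourage, ← ExpGrowth.expGrowthSup_exp (a := ((Real.log D / 2 : ℝ) : EReal))]
  refine ExpGrowth.expGrowthSup_of_eventually_ge (b := (10 : ENNReal)⁻¹) (by simp) ?_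
  filter_upwards [eventually_ge_atTop 1] with n hn
  by_cases hfin : coverMincard T F U n < ⊤
  · obtain ⟨s, hs, hcard⟩ := (coverMincard_finite_iff T F U n).mp hfin
    have hle := h n hn s hs
    have hDn : 2 ≤ (D : ℝ) ^ n := by
      calc (2 : ℝ) ≤ D := by exact_mod_cast hD
        _ ≤ (D : ℝ) ^ n := le_self_pow₀ (by exact_mod_cast (by omega : 1 ≤ D)) (by omega)
    -- An empty cover would give D^n ≤ 1. Nonemptiness allows 9c + 1 ≤ 10c.
    have hpos : 1 ≤ s.card := by
      by_contra h0
      have h0 : s.card = 0 := by omega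
      rw [h0] at hle
      norm_num at hle
      linarith
    have hpos' : (1 : ℝ) ≤ s.card := by exact_mod_cast hpos
    have hexp : Real.exp (Real.log D / 2 * n) ≤ 10 * s.card := by
      refine abs_le_of_sq_le_sq' ?_ (by positivity) |>.2
      calc Real.exp (Real.log D / 2 * n) ^ 2 = (D : ℝ) ^ n := by
            rw [← Real.exp_nat_mul]
            conv_rhs => rw [← Real.exp_log hD0, ← Real.exp_nat_mul]
            congr 1
            push_cast
            ring
        _ ≤ (9 * (s.card : ℝ) + 1) ^ 2 := hle
        _ ≤ (10 * (s.card : ℝ)) ^ 2 := by gcongr; linarith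
    rw [← hcard]
    have : (((Real.log D / 2 : ℝ) : EReal) * (n : EReal)).exp
        = ENNReal.ofReal (Real.exp (Real.log D / 2 * n)) := by
      rw [← EReal.coe_natCast, ← EReal.coe_mul, EReal.exp_coe]
    simp only [this]
    calc (10 : ENNReal)⁻¹ * ENNReal.ofReal (Real.exp (Real.log D / 2 * n))
        ≤ (10 : ENNReal)⁻¹ * ENNReal.ofReal (10 * s.card) := by gcongr
      _ = s.card := by
          rw [ENNReal.ofReal_mul (by norm_num), ← mul_assoc, ENNReal.ofReal_natCast,
            ENNReal.ofReal_ofNat, ENNReal.inv_mul_cancel (by simp) (by simp), one_mul]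
      _ = _ := by simp
  · rw [not_lt_top_iff.mp hfin]
    simp

/-! ### The symbolic model -/

lemma shift_iterate_snd {D : ℕ} (m : ℕ) (x : Symb D) (i : ℕ) :
    ((shift D)^[m] x).2 i = x.2 (m + i) := by
  induction m generalizing x with
  | zero => simp
  | succ m ih =>
    rw [Function.iterate_succ_apply, ih]
    simp [shift, Nat.add_right_comm]

lemma firstLetter_mem_uniformity (D : ℕ) :
    {p : Symb D × Symb D | p.1.2 0 = p.2.2 0} ∈ 𝓤 (Symb D) := by
  have h : {p : Fin D × Fin D | p.1 = p.2} ∈ 𝓤 (Fin D) := by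
    rw [show 𝓤 (Fin D) = 𝓟 SetRel.id from rfl]
    intro p hp
    exact hp
  have h1 : UniformContinuous fun x : Symb D => x.2 0 :=
    (Pi.uniformContinuous_proj (fun _ : ℕ => Fin D) 0).comp uniformContinuous_snd
  exact h1 h

lemma continuous_firstLetters {D n : ℕ} : Continuous (firstLetters n : Symb D → Fin n → Fin D) :=
  continuous_pi fun i => (continuous_apply (i : ℕ)).comp continuous_snd

lemma isClosed_firstLetters {D n : ℕ} (G : Finset (Fin n → Fin D)) :
    IsClosed {x : Symb D | firstLetters n x ∉ G} :=
  (isClosed_discrete {u : Fin n → Fin D | u ∉ G}).preimage continuous_firstLetters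

theorem log_div_two_le_coverEntropy_shift {D : ℕ} (hD : 2 ≤ D) {μ : Measure (Symb D)}
    (hμ : IsSemiclassicalMeasure D μ) :
    ((Real.log D / 2 : ℝ) : EReal) ≤ coverEntropy (shift D) μ.support := by
  classical
  obtain ⟨-, k, ℓ, ψ, hψ, hlim⟩ := hμ
  have hfin : ∀ j, IsFiniteMeasure (husimiMeasure (k j) (ℓ j) (ψ j)) := fun j =>
    isFiniteMeasure_husimiMeasure hD _ (hψ.le j)
  refine le_trans (log_div_two_le_coverEntropyEntourage hD fun n hn s hs => ?_)
    (coverEntropyEntourage_le_coverEntropy (shift D) μ.support (firstLetter_mem_uniformity D))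
  -- For the entourage of equal first letters, points close for n steps share their first n letters.
  let G := s.image (firstLetters n)
  have hG : Disjoint μ.support {x | firstLetters n x ∉ G} := by
    rw [Set.disjoint_left]
    intro x hx hxG
    obtain ⟨y, hy, hxy⟩ := hs hx
    refine hxG (Finset.mem_image.mpr ⟨y, hy, ?_⟩)
    funext i
    have := mem_dynEntourage.mp hxy i i.2
    simp only [Set.mem_ofPred_eq, shift_iterate_snd, add_zero] at this
    exact this.symm
  have hle := hψ.pow_le hD hn G (hlim.tendsto_measureReal (isClosed_firstLetters G) hG)
  have hcard : (G.card : ℝ) ≤ s.card := by exact_mod_cast Finset.card_image_le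
  have hs0 : (0 : ℝ) ≤ s.card := Nat.cast_nonneg _
  refine hle.trans ?_
  gcongr
  linarith

/-! ### The torus -/

lemma continuous_code (D : ℕ) : Continuous (code D) := by
  have h : Continuous fun x : ℕ → Fin D => ((Real.ofDigits x : ℝ) : UnitAddCircle) :=
    (AddCircle.continuous_mk' 1).comp Real.continuous_ofDigits
  exact (h.comp continuous_snd).prodMk (h.comp continuous_fst)

lemma coe_rep (x : UnitAddCircle) : ((rep x : ℝ) : UnitAddCircle) = x :=
  AddCircle.coe_equivIco

/-- The position coordinate evolves by itself under multiplication by D, so the discontinuity of the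
baker's map in momentum plays no role. -/
lemma baker_iterate_fst {D : ℕ} (m : ℕ) (x : Torus) :
    ((baker D)^[m] x).1 = (D ^ m) • x.1 := by
  induction m with
  | zero => simp
  | succ m ih =>
    rw [Function.iterate_succ_apply', pow_succ', mul_smul, ← ih]
    conv_rhs => rw [← coe_rep ((baker D)^[m] x).1]
    rw [← AddCircle.coe_nsmul, nsmul_eq_mul]
    rfl

/-- Multiplication by `D` on the circle is expanding: an orbit that stays close to `0` starts at
an exponentially small distance. -/
lemma mul_pow_lt_of_norm_lt {D : ℕ} (hD : 2 ≤ D) {r t : ℝ} (hr : D * r ≤ 1 / 2)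
    (ht : |t| ≤ 1 / 2) {n : ℕ}
    (h : ∀ m < n, ‖(D ^ m) • (t : UnitAddCircle)‖ < r) : ∀ m < n, (D : ℝ) ^ m * |t| < r := by
  have hD0 : (0 : ℝ) < D := by positivity
  -- Up to 1/2 the circle norm is the absolute value. The bound r at time m gives D r ≤ 1/2 at time
  -- m + 1, so no wrap-around occurs.
  have key : ∀ m, (D : ℝ) ^ m * |t| ≤ 1 / 2 →
      ‖(D ^ m) • (t : UnitAddCircle)‖ = (D : ℝ) ^ m * |t| := by
    intro m hm
    have habs : |((D : ℝ) ^ m * t)| = (D : ℝ) ^ m * |t| := by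
      rw [abs_mul, abs_of_pos (by positivity)]
    rw [← AddCircle.coe_nsmul, nsmul_eq_mul, Nat.cast_pow, ← habs]
    refine (AddCircle.norm_coe_eq_abs_iff 1 one_ne_zero).mpr ?_
    rw [habs, abs_one]
    exact hm
  intro m
  induction m with
  | zero =>
    intro hn
    rw [← key 0 (by simpa using ht)]
    exact h 0 hn
  | succ m ih =>
    intro hn
    have h1 := ih (by omega)
    rw [← key (m + 1)]
    · exact h _ hn
    · calc (D : ℝ) ^ (m + 1) * |t| = D * (D ^ m * |t|) := by ring
        _ ≤ D * r := by gcongr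
        _ ≤ 1 / 2 := hr

/-- The integer whose base `D` expansion is the word `w`. -/
def wordValue {D n : ℕ} (w : Fin n → Fin D) : ℕ :=
  finFunctionFinEquiv (w ∘ Fin.rev)

lemma wordValue_injective {D n : ℕ} :
    Function.Injective (wordValue : (Fin n → Fin D) → ℕ) := by
  intro w w' h
  have := finFunctionFinEquiv.injective (Fin.ext h)
  funext i
  simpa using congrFun this i.rev

lemma pow_mul_ofDigits {D : ℕ} (hD : 2 ≤ D) (n : ℕ) (x : Symb D) :
    (D : ℝ) ^ n * Real.ofDigits x.2
      = wordValue (firstLetters n x) + Real.ofDigits fun i => x.2 (i + n) := by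
  have hD0 : (D : ℝ) ≠ 0 := by positivity
  rw [Real.ofDigits_eq_sum_add_ofDigits x.2 n, mul_add, ← mul_assoc,
    mul_inv_cancel₀ (pow_ne_zero n hD0), one_mul]
  congr 1
  rw [wordValue, finFunctionFinEquiv_apply, Finset.sum_range, Finset.mul_sum, Nat.cast_sum,
    ← Equiv.sum_comp Fin.revPerm]
  refine Finset.sum_congr rfl fun i _ => ?_
  have : (D : ℝ) ^ n = D ^ (i : ℕ) * D ^ (n - (i + 1) + 1) := by
    rw [← pow_add]
    congr 1
    omega
  simp only [Real.ofDigitsTerm, Fin.revPerm_apply, Fin.val_rev, Function.comp_apply, firstLetters]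
  rw [this]
  push_cast
  field_simp

/-- By expansion the two positions, lifted to ℝ, differ by an integer z plus less than D^(-n)/2.
Here z records wrap-around on the circle and i the rounding errors; each takes three values, whence
the factor 9. -/
lemma exists_wordValue_eq {D n : ℕ} (hD : 2 ≤ D) (hn : 1 ≤ n) {r : ℝ} (hr : D * r ≤ 1 / 2)
    (c : UnitAddCircle) (x : Symb D)
    (h : ∀ m < n, ‖(D ^ m) • ((Real.ofDigits x.2 : ℝ) : UnitAddCircle) - (D ^ m) • c‖ < r) :
    ∃ z ∈ Finset.Icc (-1 : ℤ) 1, ∃ i ∈ Finset.Icc (-1 : ℤ) 1,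
      (wordValue (firstLetters n x) : ℤ) = ⌊(D : ℝ) ^ n * rep c⌋ + (D : ℤ) ^ n * z + i := by
  have hDn : (0 : ℝ) < (D : ℝ) ^ n := by positivity
  have hc0 : 0 ≤ rep c := (AddCircle.equivIco (1 : ℝ) 0 c).2.1
  have hc1 : rep c < 1 :=
    (AddCircle.equivIco (1 : ℝ) 0 c).2.2.trans_eq (zero_add 1)
  have hx0 := Real.ofDigits_nonneg x.2
  have hx1 := Real.ofDigits_le_one x.2
  set d := Real.ofDigits x.2 - rep c with hd
  set z := round d with hz
  have hround := abs_sub_round d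
  have hcoe : ((d - z : ℝ) : UnitAddCircle) = ((Real.ofDigits x.2 : ℝ) : UnitAddCircle) - c := by
    have : ((z : ℝ) : UnitAddCircle) = 0 := by
      rw [AddCircle.coe_eq_zero_iff]
      exact ⟨z, by simp⟩
    rw [AddCircle.coe_sub, this, sub_zero, hd, AddCircle.coe_sub, coe_rep]
  have hexp := mul_pow_lt_of_norm_lt hD hr hround (n := n) (fun m hm => by
    rw [hcoe, smul_sub]
    exact h m hm) (n - 1) (by omega)
  have hsmall : |(D : ℝ) ^ n * (d - z)| < 1 / 2 := by
    rw [abs_mul, abs_of_pos hDn]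
    calc (D : ℝ) ^ n * |d - z| = D * (D ^ (n - 1) * |d - z|) := by
          rw [← mul_assoc, ← pow_succ', Nat.sub_add_cancel hn]
      _ < D * r := by gcongr
      _ ≤ 1 / 2 := hr
  have hval := pow_mul_ofDigits hD n x
  have ht0 := Real.ofDigits_nonneg fun i => x.2 (i + n)
  have ht1 := Real.ofDigits_le_one fun i => x.2 (i + n)
  have hf0 := Int.floor_le ((D : ℝ) ^ n * rep c)
  have hf1 := Int.lt_floor_add_one ((D : ℝ) ^ n * rep c)
  rw [abs_lt] at hsmall
  rw [abs_le] at hround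
  refine ⟨z, ?_, wordValue (firstLetters n x) - ⌊(D : ℝ) ^ n * rep c⌋ - (D : ℤ) ^ n * z, ?_,
    by ring⟩
  · have h1 : (-2 : ℝ) < z := by linarith
    have h2 : (z : ℝ) < 2 := by linarith
    rw [Finset.mem_Icc]
    have h1' : (-2 : ℤ) < z := by exact_mod_cast h1
    have h2' : z < 2 := by exact_mod_cast h2
    omega
  · have heq : (D : ℝ) ^ n * (d - z) = wordValue (firstLetters n x)
        + (Real.ofDigits fun i => x.2 (i + n)) - D ^ n * rep c - D ^ n * z := by
      rw [hd, ← hval]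
      ring
    set e : ℤ := wordValue (firstLetters n x) - ⌊(D : ℝ) ^ n * rep c⌋ - (D : ℤ) ^ n * z with he
    have hecast : (e : ℝ) = wordValue (firstLetters n x) - ⌊(D : ℝ) ^ n * rep c⌋ - D ^ n * z := by
      rw [he]
      push_cast
      ring
    have h1 : (-2 : ℝ) < e := by linarith
    have h2 : (e : ℝ) < 2 := by linarith
    rw [Finset.mem_Icc]
    have h1' : (-2 : ℤ) < e := by exact_mod_cast h1
    have h2' : e < 2 := by exact_mod_cast h2
    omega

lemma position_mem_uniformity {r : ℝ} (hr : 0 < r) :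
    {p : Torus × Torus | ‖p.1.1 - p.2.1‖ < r} ∈ 𝓤 Torus := by
  have h : {p : UnitAddCircle × UnitAddCircle | dist p.1 p.2 < r} ∈ 𝓤 UnitAddCircle :=
    Metric.dist_mem_uniformity hr
  simp only [dist_eq_norm] at h
  exact uniformContinuous_fst h

theorem log_div_two_le_coverEntropy_baker {D : ℕ} (hD : 2 ≤ D) {μ : Measure Torus}
    (hμ : IsTorusSemiclassicalMeasure D μ) :
    ((Real.log D / 2 : ℝ) : EReal) ≤ coverEntropy (baker D) μ.support := by
  classical
  obtain ⟨-, k, ℓ, ψ, hψ, hlim⟩ := hμ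
  have hfin : ∀ j, IsFiniteMeasure (husimiMeasure (k j) (ℓ j) (ψ j)) := fun j =>
    isFiniteMeasure_husimiMeasure hD _ (hψ.le j)
  have hfin' : ∀ j, IsFiniteMeasure (torusHusimiMeasure (k j) (ℓ j) (ψ j)) := fun j =>
    Measure.isFiniteMeasure_map _ _
  have hD0 : (0 : ℝ) < D := by positivity
  have hr : (D : ℝ) * (1 / (2 * D)) ≤ 1 / 2 := by
    field_simp
    exact le_rfl
  refine le_trans (log_div_two_le_coverEntropyEntourage hD fun n hn s hs => ?_)
    (coverEntropyEntourage_le_coverEntropy (baker D) μ.support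
      (position_mem_uniformity (show (0 : ℝ) < 1 / (2 * D) by positivity)))
  -- Coding is not injective, so a word is kept as soon as one of its sequences codes a support
  -- point.
  let G : Finset (Fin n → Fin D) :=
    Finset.univ.filter fun w => ∃ x, firstLetters n x = w ∧ code D x ∈ μ.support
  let K := code D '' {x | firstLetters n x ∉ G}
  have hK : IsClosed K := ((isClosed_firstLetters G).isCompact.image (continuous_code D)).isClosed
  have hdisj : Disjoint μ.support K := by
    rw [Set.disjoint_right]
    rintro _ ⟨x, hx, rfl⟩ hxμ
    exact hx (Finset.mem_filter.mpr ⟨Finset.mem_univ _, x, rfl, hxμ⟩)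
  have htend : Tendsto
      (fun j => (husimiMeasure (k j) (ℓ j) (ψ j)).real {x | firstLetters n x ∉ G}) atTop (𝓝 0) := by
    refine squeeze_zero (fun j => measureReal_nonneg) (fun j => ?_)
      (hlim.tendsto_measureReal hK hdisj)
    rw [torusHusimiMeasure, map_measureReal_apply (continuous_code D).measurable hK.measurableSet]
    -- The preimage of K may exceed the cylinder event, but only this inclusion is needed.
    exact measureReal_mono (Set.subset_preimage_image _ _)
  have hle := hψ.pow_le hD hn G htend
  have hcard : G.card ≤ 9 * s.card := by
    let g : Torus × ℤ × ℤ → ℤ := fun p =>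
      ⌊(D : ℝ) ^ n * rep p.1.1⌋ + (D : ℤ) ^ n * p.2.1 + p.2.2
    let B := Finset.Icc (-1 : ℤ) 1
    have hsub : G.image (fun w => (wordValue w : ℤ)) ⊆ (s ×ˢ B ×ˢ B).image g := by
      intro a ha
      obtain ⟨w, hw, rfl⟩ := Finset.mem_image.mp ha
      obtain ⟨x, rfl, hx⟩ := (Finset.mem_filter.mp hw).2
      obtain ⟨c, hc, hxc⟩ := hs hx
      obtain ⟨z, hz, i, hi, heq⟩ := exists_wordValue_eq hD hn hr c.1 x fun m hm => by
        have := mem_dynEntourage.mp hxc m hm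
        simp only [Set.mem_ofPred_eq, baker_iterate_fst] at this
        exact this
      refine Finset.mem_image.mpr ⟨(c, z, i), ?_, heq.symm⟩
      exact Finset.mem_product.mpr ⟨hc, Finset.mem_product.mpr ⟨hz, hi⟩⟩
    have hinj : Function.Injective fun w : Fin n → Fin D => (wordValue w : ℤ) :=
      Nat.cast_injective.comp wordValue_injective
    rw [← Finset.card_image_of_injective G hinj]
    refine (Finset.card_le_card hsub).trans (Finset.card_image_le.trans ?_)
    simp [B]
    omega
  have hcard' : (G.card : ℝ) ≤ 9 * s.card := by exact_mod_cast hcard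
  refine hle.trans ?_
  gcongr

end WalshBaker

end

theorem theorem1 (D : ℕ) (hD : 2 ≤ D) :
    (∀ μ : MeasureTheory.Measure (WalshBaker.Symb D), WalshBaker.IsSemiclassicalMeasure D μ →
      ((Real.log D / 2 : ℝ) : EReal) ≤ Dynamics.coverEntropy (WalshBaker.shift D) μ.support) ∧
    (∀ μ : MeasureTheory.Measure WalshBaker.Torus, WalshBaker.IsTorusSemiclassicalMeasure D μ →
      ((Real.log D / 2 : ℝ) : EReal) ≤ Dynamics.coverEntropy (WalshBaker.baker D) μ.support) :=
  ⟨fun _ hμ => WalshBaker.log_div_two_le_coverEntropy_shift hD hμ,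
    fun _ hμ => WalshBaker.log_div_two_le_coverEntropy_baker hD hμ⟩
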